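/- **Lemma (Convergence of micro-macro Parareal for the evolution of the covariance).** Let $\alpha,\beta,\gamma,\zeta,\sigma\in\mathbb R$ and $T>0$. For $\epsilon>0$ consider the covariance equation of the slow-fast Ornstein–Uhlenbeck SDE $dx=(\alpha x+\beta y)\,dt+\sigma\,dW_1$, $dy=\frac1\epsilon(\gamma x+\zeta y)\,dt+\frac{\sigma}{\sqrt\epsilon}\,dW_2$, that is, the affine ODE $\dot\Sigma=B_\Sigma\Sigma+b_\Sigma$, $\Sigma(0)=\Sigma_0=(\Sigma_{x,0},\Sigma_{xy,0},\Sigma_{y,0})\in\mathbb R^3$ for $\Sigma=(\Sigma_x,\Sigma_{xy},\Sigma_y)$, with $$B_\Sigma=\begin{bmatrix}2\alpha&2\beta&0\\ \gamma/\epsilon&\alpha+\zeta/\epsilon&\beta\\ 0&2\gamma/\epsilon&2\zeta/\epsilon\end{bmatrix}=\begin{bmatrix}2\alpha&p_\Sigma^T\\ q_\Sigma/\epsilon&-A_\Sigma(\epsilon)/\epsilon\end{bmatrix},\qquad b_\Sigma=\begin{bmatrix}\sigma^2\\0\\ \sigma^2/\epsilon\end{bmatrix},$$ $$p_\Sigma=\begin{bmatrix}2\beta\\0\end{bmatrix},\quad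 q_\Sigma=\begin{bmatrix}\gamma\\0\end{bmatrix},\quad A_\Sigma(\epsilon)=-\begin{bmatrix}\alpha\epsilon+\zeta&\beta\epsilon\\2\gamma&2\zeta\end{bmatrix},$$ and the variance equation of the averaged SDE, $\dot\Sigma_X=\lambda_\Sigma\Sigma_X+\sigma^2$, with $\lambda_\Sigma=2(\alpha-\beta\gamma/\zeta)$. Assume that there is $\mu_{\Sigma,-}>0$ such that every complex eigenvalue $\mu$ of $A_\Sigma(\epsilon)$ satisfies $\operatorname{Re}\mu\ge\mu_{\Sigma,-}$ for all $\epsilon\in(0,1)$; that $\lambda_\Sigma\ne0$; and that $\lambda_{\Sigma,\epsilon}=2\alpha+p_\Sigma^TA_\Sigma(\epsilon)^{-1}q_\Sigma\ne0$ for all $\epsilon\in(0,1)$. Put $t^{\mathrm{BL}}_{\Sigma,\epsilon}=\frac{2\epsilon}{\mu_{\Sigma,-}}\ln\frac1\epsilon$. Let $N\Delta t=T$ with $N\ge 1$ an integer and $t_n=n\Delta t$. Let $\mathcal F$ and $\mathcal C$ be the exact time-$\Delta t$ solution maps of the covariance equation and of the averaged variance equation, respectively, and let $$\mathcal R(\Sigma_x,\Sigma_{xy},\Sigma_y)=\Sigma_x,\quad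 \mathcal M(S,(\Sigma_x,\Sigma_{xy},\Sigma_y))=(S,\Sigma_{xy},\Sigma_y),\quad \mathcal L(S)=(S,\Sigma_{xy,0},\Sigma_{y,0}).$$ The micro-macro Parareal iterates $X_n^k\in\mathbb R$, $\Sigma_n^k\in\mathbb R^3$ are defined by $X_0^k=\Sigma_{x,0}$, $\Sigma^k_0=\Sigma_0$ for all $k\ge0$ and, for $0\le n\le N-1$ and $k\ge0$, by $$X_{n+1}^0=\mathcal C(X_n^0),\qquad \Sigma_{n+1}^0=\mathcal L(X_{n+1}^0),$$ $$X_{n+1}^{k+1}=\mathcal C(X_n^{k+1})+\mathcal R(\mathcal F(\Sigma_n^k))-\mathcal C(X_n^k),\qquad \Sigma_{n+1}^{k+1}=\mathcal M\bigl(X_{n+1}^{k+1},\mathcal F(\Sigma_n^k)\bigr).$$ Let $e^k_{\Sigma,n}=\Sigma_n^k-\Sigma(t_n)$ be the micro error and $E^k_{\Sigma,n}=\mathcal R\Sigma_n^k-\mathcal R\Sigma(t_n)$ the macro error. Then there exists $\epsilon_0\in(0,1)$, depending only on $\alpha,p_\Sigma,q_\Sigma,A_\Sigma$ and $T$ (that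 is, on $\alpha,\beta,\gamma,\zeta,T$), such that for every such $\Delta t$ and every $k\ge0$ there is a constant $C_k$, independent of $\epsilon$ (it may depend on $\Delta t$, on $\Sigma_0$ and on the parameters), such that for all $0<\epsilon<\epsilon_0$ with $t^{\mathrm{BL}}_{\Sigma,\epsilon}<\Delta t$: $$\sup_{0\le n\le N}|E^k_{\Sigma,n}|\le C_k\,\epsilon^{\lceil (k+1)/2\rceil},\qquad \sup_{0\le n\le N}\|e^k_{\Sigma,n}\|\le C_k\,\epsilon^{\lfloor (k+1)/2\rfloor},$$ where $\|\cdot\|$ is the Euclidean norm. -/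

import Mathlib

noncomputable section

namespace MicroMacro

/-! ### Exact solution of an affine constant-coefficient ODE -/

section AffineFlow

variable {E : Type*} [NormedAddCommGroup E] [NormedSpace ℝ E]

/-- The value at time `t` of the solution of `u' = A u + b`, `u 0 = v`
(variation of constants; `affineFlow_zero` and `hasDerivAt_affineFlow` below confirm this). -/
def affineFlow (A : E →L[ℝ] E) (b : E) (t : ℝ) (v : E) : E :=
  NormedSpace.exp (t • A) v + ∫ s in (0 : ℝ)..t, NormedSpace.exp (s • A) b

theorem affineFlow_zero (A : E →L[ℝ] E) (b v : E) : affineFlow A b 0 v = v := by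
  simp [affineFlow]

theorem hasDerivAt_exp_smul_apply [CompleteSpace E] (A : E →L[ℝ] E) (v : E) (t : ℝ) :
    HasDerivAt (fun s : ℝ => NormedSpace.exp (s • A) v)
      (A (NormedSpace.exp (t • A) v)) t := by
  have h := (hasDerivAt_exp_smul_const' (𝕂 := ℝ) A t)
  exact h.clm_apply (hasDerivAt_const t v) |>.congr_deriv (by simp)

theorem hasDerivAt_affineFlow [CompleteSpace E] (A : E →L[ℝ] E) (b v : E) (t : ℝ) :
    HasDerivAt (fun s => affineFlow A b s v) (A (affineFlow A b t v) + b) t := by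
  have hc : Continuous fun s : ℝ => NormedSpace.exp (s • A) b :=
    continuous_iff_continuousAt.2 fun s => (hasDerivAt_exp_smul_apply A b s).continuousAt
  have h1 := hasDerivAt_exp_smul_apply A v t
  have h2 : HasDerivAt (fun r : ℝ => ∫ s in (0 : ℝ)..r, NormedSpace.exp (s • A) b)
      (NormedSpace.exp (t • A) b) t :=
    intervalIntegral.integral_hasDerivAt_right (hc.intervalIntegrable _ _)
      (hc.stronglyMeasurableAtFilter _ _) hc.continuousAt
  have h3 : A (∫ s in (0 : ℝ)..t, NormedSpace.exp (s • A) b)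
      = NormedSpace.exp (t • A) b - b := by
    rw [← A.intervalIntegral_comp_comm (hc.intervalIntegrable _ _),
      intervalIntegral.integral_eq_sub_of_hasDerivAt
        (fun s _ => hasDerivAt_exp_smul_apply A b s)
        ((A.continuous.comp hc).intervalIntegrable _ _)]
    simp
  refine (h1.add h2).congr_deriv ?_
  rw [affineFlow, map_add, h3]
  abel

end AffineFlow

/-! ### The micro-macro Parareal algorithm -/

section Parareal

variable {Y U : Type*} [AddCommGroup Y]

/-- Zeroth iteration `n ↦ (X_n^0, u_n^0)`, with coarse propagator `C` and lifting `L`. -/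
def pararealInit (C : Y → Y) (L : Y → U) (X₀ : Y) (u₀ : U) : ℕ → Y × U
  | 0 => (X₀, u₀)
  | n + 1 =>
    let X := C (pararealInit C L X₀ u₀ n).1
    (X, L X)

/-- One iteration: from `prev n = (X_n^k, u_n^k)` to `n ↦ (X_n^{k+1}, u_n^{k+1})`, with coarse and
fine propagators `C`, `F`, restriction `R` and matching `M`. -/
def pararealStep (C : Y → Y) (F : U → U) (R : U → Y) (M : Y → U → U) (X₀ : Y) (u₀ : U)
    (prev : ℕ → Y × U) : ℕ → Y × U
  | 0 => (X₀, u₀)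
  | n + 1 =>
    let X := C (pararealStep C F R M X₀ u₀ prev n).1 + R (F (prev n).2) - C (prev n).1
    (X, M X (F (prev n).2))

/-- Iterates of micro-macro Parareal: `parareal C F R L M u₀ k n = (X_n^k, u_n^k)`, started from
the micro state `u₀` and the macro state `R u₀`. -/
def parareal (C : Y → Y) (F : U → U) (R : U → Y) (L : Y → U) (M : Y → U → U) (u₀ : U) :
    ℕ → ℕ → Y × U
  | 0 => pararealInit C L (R u₀) u₀
  | k + 1 => pararealStep C F R M (R u₀) u₀ (parareal C F R L M u₀ k)

end Parareal

/-! ### Covariance equations of the slow-fast Ornstein–Uhlenbeck process -/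

/-- Micro states `(Σ_x, Σ_xy, Σ_y)`, with the Euclidean norm. -/
abbrev CovState := EuclideanSpace ℝ (Fin 3)

/-- The matrix `B_Σ(ε)` of the multiscale covariance equation. -/
def BSigma (α β γ ζ ε : ℝ) : Matrix (Fin 3) (Fin 3) ℝ :=
  !![2 * α, 2 * β, 0;
     γ / ε, α + ζ / ε, β;
     0, 2 * γ / ε, 2 * ζ / ε]

/-- The inhomogeneity `b_Σ(ε)` of the multiscale covariance equation. -/
def bSigma (σ ε : ℝ) : CovState := !₂[σ ^ 2, 0, σ ^ 2 / ε]

/-- The matrix `A_Σ(ε)`: the fast-fast block of `B_Σ(ε)` is `-A_Σ(ε)/ε`. -/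
def ASigma (α β γ ζ ε : ℝ) : Matrix (Fin 2) (Fin 2) ℝ :=
  -!![α * ε + ζ, β * ε;
      2 * γ, 2 * ζ]

/-- The slow-fast block of `B_Σ(ε)`, as a row vector. -/
def pSigma (β : ℝ) : Fin 2 → ℝ := ![2 * β, 0]

/-- The fast-slow block of `B_Σ(ε)` is `q_Σ/ε`. -/
def qSigma (γ : ℝ) : Fin 2 → ℝ := ![γ, 0]

/-- Decay parameter `λ_Σ` of the variance of the averaged SDE. -/
def lambdaSigma (α β γ ζ : ℝ) : ℝ := 2 * (α - β * γ / ζ)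

/-- `λ_{Σ,ε} = 2α + p_Σᵀ A_Σ(ε)⁻¹ q_Σ`. -/
def lambdaSigmaEps (α β γ ζ ε : ℝ) : ℝ :=
  2 * α + pSigma β ⬝ᵥ (Matrix.mulVec (ASigma α β γ ζ ε)⁻¹ (qSigma γ))

/-- Solution at time `t` of `Σ' = B_Σ Σ + b_Σ` with initial value `v`. -/
def fineFlow (α β γ ζ σ ε t : ℝ) (v : CovState) : CovState :=
  affineFlow (Matrix.toEuclideanCLM (n := Fin 3) (𝕜 := ℝ) (BSigma α β γ ζ ε)) (bSigma σ ε) t v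

/-- Solution at time `t` of `S' = λ_Σ S + σ²` with initial value `S`. -/
def coarseFlow (α β γ ζ σ t : ℝ) (S : ℝ) : ℝ :=
  affineFlow (lambdaSigma α β γ ζ • ContinuousLinearMap.id ℝ ℝ) (σ ^ 2) t S

/-- Restriction: keep the slow variance. -/
def restrict (v : CovState) : ℝ := v 0

/-- Matching: replace the slow variance, keep the fast moments. -/
def matching (S : ℝ) (v : CovState) : CovState := !₂[S, v 1, v 2]

/-- Lifting: reset the fast moments to their values in the initial state `s₀ = Σ(0)`. -/
def lifting (s₀ : CovState) (S : ℝ) : CovState := !₂[S, s₀ 1, s₀ 2]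

/-- The micro state `Σ_n^k` of micro-macro Parareal with time step `Δt`. -/
def covIterate (α β γ ζ σ : ℝ) (s₀ : CovState) (ε Δt : ℝ) (k n : ℕ) : CovState :=
  (parareal (coarseFlow α β γ ζ σ Δt) (fineFlow α β γ ζ σ ε Δt)
    restrict (lifting s₀) matching s₀ k n).2

/-- Micro error `Σ_n^k - Σ(t_n)`, `t_n = n Δt`. -/
def microError (α β γ ζ σ : ℝ) (s₀ : CovState) (ε Δt : ℝ) (k n : ℕ) : CovState :=
  covIterate α β γ ζ σ s₀ ε Δt k n - fineFlow α β γ ζ σ ε (n * Δt) s₀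

/-- Macro error `R Σ_n^k - R Σ(t_n)`. -/
def macroError (α β γ ζ σ : ℝ) (s₀ : CovState) (ε Δt : ℝ) (k n : ℕ) : ℝ :=
  restrict (covIterate α β γ ζ σ s₀ ε Δt k n) - restrict (fineFlow α β γ ζ σ ε (n * Δt) s₀)

/-- `μ` is a positive lower bound, uniform in `ε ∈ (0,1)`, for the real parts of the complex
eigenvalues of `A_Σ(ε)`. -/
def IsFastDecayRate (α β γ ζ μ : ℝ) : Prop :=
  0 < μ ∧ ∀ ε ∈ Set.Ioo (0 : ℝ) 1,
    ∀ z ∈ spectrum ℂ ((ASigma α β γ ζ ε).map (algebraMap ℝ ℂ)), μ ≤ z.re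

/-- Length of the boundary layer in time. -/
def boundaryLayer (μ ε : ℝ) : ℝ := 2 * ε / μ * Real.log (1 / ε)

end MicroMacro

end

/-! In the variables `w = Σ_xy + gΣ_x` and `r = Σ_y - g²Σ_x + σ²/(2ζ)`, `g = γ/ζ`, the covariance
equation becomes a slow variable driven by fast ones that relax at rate `1/ε`, with forcing bounded
by the state. A weighted energy estimate shows that at the fixed time `Δt` the fast variables are
`O(ε)` and `Σ_x` is `O(ε)`-close to the averaged flow, with constants linear in the data
(`exists_fineFlow_asymptotics`). The initial fast moments thus survive only through a factor `ε`.

Differences of solutions solve the same equations with `σ = 0`, so these bounds also govern the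
errors. The macro error sees the previous micro error only through fine minus coarse flow, which
gains a power of `ε`; the fast part of the micro error inherits the order of the previous macro
error. Hence orders `(a, b)` of (macro, micro) error become `(b + 1, a)` (`exists_error_le_step`).
From `(1, 0)` this yields `⌈(k+1)/2⌉` and `⌊(k+1)/2⌋`. -/

namespace MicroMacro

/-! ### Scalar and differential inequalities. -/

/-- Grönwall's inequality for a scalar differential inequality, with a rate of either sign. -/
theorem le_exp_mul_of_hasDerivAt_le {f f' : ℝ → ℝ} {a b t : ℝ} (ha : a ≠ 0) (ht : 0 ≤ t)
    (hf : ∀ u, HasDerivAt f (f' u) u) (hle : ∀ u ∈ Set.Icc 0 t, f' u ≤ a * f u + b) :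
    f t + b / a ≤ Real.exp (a * t) * (f 0 + b / a) := by
  have hg : ∀ u, HasDerivAt (fun u => Real.exp (-a * u) * (f u + b / a))
      (Real.exp (-a * u) * (f' u - (a * f u + b))) u := by
    intro u
    have h1 : HasDerivAt (fun u => Real.exp (-a * u)) (Real.exp (-a * u) * (-a)) u := by
      simpa using ((hasDerivAt_id u).const_mul (-a)).exp
    refine (h1.mul ((hf u).add_const (b / a))).congr_deriv ?_
    field_simp
    ring
  have hanti : AntitoneOn (fun u => Real.exp (-a * u) * (f u + b / a)) (Set.Icc 0 t) := by
    refine antitoneOn_of_deriv_nonpos (convex_Icc 0 t)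
      (fun u _ => (hg u).continuousAt.continuousWithinAt)
      (fun u _ => (hg u).differentiableAt.differentiableWithinAt) fun u hu => ?_
    rw [(hg u).deriv]
    have := hle u (interior_subset hu)
    exact mul_nonpos_of_nonneg_of_nonpos (Real.exp_pos _).le (by linarith)
  have h := hanti (Set.left_mem_Icc.2 ht) (Set.right_mem_Icc.2 ht) ht
  simp only [mul_zero, Real.exp_zero, one_mul] at h
  calc f t + b / a = Real.exp (a * t) * (Real.exp (-a * t) * (f t + b / a)) := by
        rw [← mul_assoc, ← Real.exp_add]; simp
    _ ≤ _ := mul_le_mul_of_nonneg_left h (Real.exp_pos _).le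

/-- Cauchy–Schwarz in `ℝ⁴`; the six squares are those of Lagrange's identity. -/
theorem sq_linear_combination_le (a b c d x y z s : ℝ) :
    (a * x + b * y + c * z + d * s) ^ 2 ≤
      (a ^ 2 + b ^ 2 + c ^ 2 + d ^ 2) * (x ^ 2 + y ^ 2 + z ^ 2 + s ^ 2) := by
  nlinarith [sq_nonneg (a * y - b * x), sq_nonneg (a * z - c * x), sq_nonneg (a * s - d * x),
    sq_nonneg (b * z - c * y), sq_nonneg (b * s - d * y), sq_nonneg (c * s - d * z)]

/-- Young's inequality with weight `κ`. -/
theorem two_mul_le_weighted {κ : ℝ} (hκ : 0 < κ) (a b : ℝ) :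
    2 * a * b ≤ κ * a ^ 2 + b ^ 2 / κ := by
  have h : κ * a ^ 2 + b ^ 2 / κ - 2 * a * b = (κ * a - b) ^ 2 / κ := by
    field_simp; ring
  have : 0 ≤ (κ * a - b) ^ 2 / κ := by positivity
  linarith

/-- Dissipation of the weighted energy of the fast variables. -/
theorem fast_energy_dissipation {m ε : ℝ} (hm : 0 < m) (hε : 0 < ε) (g w r f₁ f₂ : ℝ) :
    (2 * g ^ 2 + 1) * (2 * w * (-(m / ε) * w + f₁)) +
        2 * r * (-(2 * m / ε) * (r + g * w) + f₂) ≤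
      -(m / (2 * ε)) * ((2 * g ^ 2 + 1) * w ^ 2 + r ^ 2) +
        ε * (2 / m * ((2 * g ^ 2 + 1) * f₁ ^ 2 + f₂ ^ 2)) := by
  have hκ : 0 < m / (2 * ε) := by positivity
  have h1 := two_mul_le_weighted hκ w f₁
  have h2 := two_mul_le_weighted hκ r f₂
  have e : ∀ b : ℝ, b ^ 2 / (m / (2 * ε)) = ε * (2 / m * b ^ 2) := fun b => by
    field_simp
  rw [e] at h1 h2
  have h1' := mul_le_mul_of_nonneg_left h1 (by positivity : (0 : ℝ) ≤ 2 * g ^ 2 + 1)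
  -- Since `2r(r + gw) = r² + (r + gw)² - g²w²`, the coupling costs a multiple of `g²w²`, paid for
  -- by the extra weight `2g²` on `w²`.
  have h3 : 0 ≤ m / (2 * ε) * (2 * w ^ 2 + 4 * (r + g * w) ^ 2) := by positivity
  have e1 : m / ε = 2 * (m / (2 * ε)) := by field_simp
  have e2 : 2 * m / ε = 4 * (m / (2 * ε)) := by field_simp; norm_num
  rw [e1, e2]
  nlinarith [h1', h2, h3]

theorem exp_neg_le_two_div_sq {u : ℝ} (hu : 0 < u) : Real.exp (-u) ≤ 2 / u ^ 2 := by
  have h := Real.quadratic_le_exp_of_nonneg hu.le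
  rw [Real.exp_neg, inv_le_comm₀ (Real.exp_pos _) (by positivity), inv_div]
  linarith

/-! ### Energy estimates for slow-fast systems. -/

/-- A slow variable `x` driven by fast variables `w`, `r` that relax at rate `1 / ε`, with
forcings `f₁`, `f₂` bounded by the state and a constant source `s`. -/
structure IsSlowFast (m g lam b c ε s : ℝ) (x w r f₁ f₂ : ℝ → ℝ) : Prop where
  slow : ∀ u, HasDerivAt x (lam * x u + b * w u + s) u
  fast_fst : ∀ u, HasDerivAt w (-(m / ε) * w u + f₁ u) u
  fast_snd : ∀ u, HasDerivAt r (-(2 * m / ε) * (r u + g * w u) + f₂ u) u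
  sq_fst_le : ∀ u, f₁ u ^ 2 ≤ c * (x u ^ 2 + w u ^ 2 + r u ^ 2 + s ^ 2)
  sq_snd_le : ∀ u, f₂ u ^ 2 ≤ c * (x u ^ 2 + w u ^ 2 + r u ^ 2 + s ^ 2)

/-- Weighted energy of the fast variables. -/
def fastEnergy (g w r : ℝ) : ℝ := (2 * g ^ 2 + 1) * w ^ 2 + r ^ 2

theorem sq_add_sq_le_fastEnergy (g w r : ℝ) : w ^ 2 + r ^ 2 ≤ fastEnergy g w r := by
  unfold fastEnergy
  nlinarith [mul_nonneg (sq_nonneg g) (sq_nonneg w)]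

/-- Coupling constant between the fast energy and the total energy. -/
noncomputable def couplingConst (m g c : ℝ) : ℝ := 2 / m * ((2 * g ^ 2 + 2) * c)

/-- Growth rate of the total energy, uniform in `ε`. -/
noncomputable def growthRate (m g lam b c : ℝ) : ℝ := 2 * |lam| + b ^ 2 + 2 + couplingConst m g c

namespace IsSlowFast

variable {m g lam b c ε s : ℝ} {x w r f₁ f₂ : ℝ → ℝ}

theorem fastEnergy_deriv (h : IsSlowFast m g lam b c ε s x w r f₁ f₂) (hm : 0 < m) (hε : 0 < ε)
    (hc : 0 ≤ c) (u : ℝ) :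
    ∃ d, HasDerivAt (fun u => fastEnergy g (w u) (r u)) d u ∧
      d ≤ -(m / (2 * ε)) * fastEnergy g (w u) (r u) +
        ε * (couplingConst m g c * (x u ^ 2 + fastEnergy g (w u) (r u) + s ^ 2)) := by
  refine ⟨_, (((h.fast_fst u).pow 2).const_mul (2 * g ^ 2 + 1)).add ((h.fast_snd u).pow 2), ?_⟩
  have h1 := fast_energy_dissipation hm hε g (w u) (r u) (f₁ u) (f₂ u)
  set S := x u ^ 2 + fastEnergy g (w u) (r u) + s ^ 2 with hS
  have hle : c * (x u ^ 2 + w u ^ 2 + r u ^ 2 + s ^ 2) ≤ c * S :=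
    mul_le_mul_of_nonneg_left (by linarith [sq_add_sq_le_fastEnergy g (w u) (r u)]) hc
  have h2 : (2 * g ^ 2 + 1) * f₁ u ^ 2 + f₂ u ^ 2 ≤ (2 * g ^ 2 + 2) * c * S := by
    have := mul_le_mul_of_nonneg_left ((h.sq_fst_le u).trans hle)
      (by positivity : (0 : ℝ) ≤ 2 * g ^ 2 + 1)
    linarith [(h.sq_snd_le u).trans hle]
  have h3 : ε * (2 / m * ((2 * g ^ 2 + 1) * f₁ u ^ 2 + f₂ u ^ 2)) ≤
      ε * (couplingConst m g c * S) := by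
    rw [couplingConst, mul_assoc (2 / m)]
    gcongr
  have e : fastEnergy g (w u) (r u) = (2 * g ^ 2 + 1) * w u ^ 2 + r u ^ 2 := rfl
  rw [← e] at h1
  refine le_trans (le_of_eq ?_) (h1.trans (by linarith))
  simp only [Nat.cast_ofNat, Nat.reduceSub, pow_one]

/-- The stiff term only dissipates and is dropped, so the growth rate stays bounded as `ε → 0`.
Counting `s²` in the energy makes the inequality homogeneous. -/
theorem energy_le (h : IsSlowFast m g lam b c ε s x w r f₁ f₂) (hm : 0 < m) (hε : 0 < ε)
    (hε1 : ε < 1) (hc : 0 ≤ c) {t : ℝ} (ht : 0 ≤ t) :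
    x t ^ 2 + fastEnergy g (w t) (r t) + s ^ 2 ≤
      Real.exp (growthRate m g lam b c * t) *
        (x 0 ^ 2 + fastEnergy g (w 0) (r 0) + s ^ 2) := by
  choose d hd hdle using h.fastEnergy_deriv hm hε hc
  have hcc : 0 ≤ couplingConst m g c := by unfold couplingConst; positivity
  have hL : 0 < growthRate m g lam b c := by unfold growthRate; positivity
  have key := le_exp_mul_of_hasDerivAt_le (b := 0) hL.ne' ht
    (fun u => (((h.slow u).pow 2).add (hd u)).add_const (s ^ 2)) (fun u _ => ?_)
  · simpa using key
  simp only [Nat.cast_ofNat, Nat.reduceSub, pow_one, add_zero, Pi.add_apply, Pi.pow_apply]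
  have hQ := sq_add_sq_le_fastEnergy g (w u) (r u)
  have hd' := hdle u
  set Q := fastEnergy g (w u) (r u)
  have hQ0 : 0 ≤ Q := le_trans (by positivity) hQ
  have h1 : 0 ≤ m / (2 * ε) * Q := by positivity
  have h2 : ε * (couplingConst m g c * (x u ^ 2 + Q + s ^ 2)) ≤
      couplingConst m g c * (x u ^ 2 + Q + s ^ 2) :=
    mul_le_of_le_one_left (by positivity) hε1.le
  have h3 : lam * x u ^ 2 ≤ |lam| * x u ^ 2 :=
    mul_le_mul_of_nonneg_right (le_abs_self _) (sq_nonneg _)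
  have h4 : 0 ≤ |lam| * (Q + s ^ 2) := by positivity
  have h5 : b ^ 2 * w u ^ 2 ≤ b ^ 2 * Q :=
    mul_le_mul_of_nonneg_left (by linarith [sq_nonneg (r u)]) (sq_nonneg _)
  have h6 : 0 ≤ b ^ 2 * (x u ^ 2 + s ^ 2) := by positivity
  unfold growthRate
  nlinarith [sq_nonneg (x u - b * w u), sq_nonneg (x u - s), sq_nonneg s]

/-- With the total energy frozen at its maximal size `G * W`, the fast energy relaxes at rate
`m/(2ε)` under a source of size `ε`. Its equilibrium level is `O(ε²)`, and the initial layer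
`exp(-mt/(2ε))` is `O(ε²)` too for fixed `t > 0`. -/
theorem fastEnergy_le (h : IsSlowFast m g lam b c ε s x w r f₁ f₂) (hm : 0 < m) (hε : 0 < ε)
    (hε1 : ε < 1) (hc : 0 ≤ c) {t : ℝ} (ht : 0 < t) :
    fastEnergy g (w t) (r t) ≤
      (8 / (m * t) ^ 2 +
          2 / m * (couplingConst m g c * Real.exp (growthRate m g lam b c * t))) * ε ^ 2 *
        (x 0 ^ 2 + fastEnergy g (w 0) (r 0) + s ^ 2) := by
  choose d hd hdle using h.fastEnergy_deriv hm hε hc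
  have hcc : 0 ≤ couplingConst m g c := by unfold couplingConst; positivity
  have hL : 0 < growthRate m g lam b c := by unfold growthRate; positivity
  have hQ0 : 0 ≤ fastEnergy g (w 0) (r 0) :=
    le_trans (by positivity) (sq_add_sq_le_fastEnergy g (w 0) (r 0))
  set W := x 0 ^ 2 + fastEnergy g (w 0) (r 0) + s ^ 2 with hW
  have hW0 : 0 ≤ W := by positivity
  set G := Real.exp (growthRate m g lam b c * t) with hG
  have ha : -(m / (2 * ε)) ≠ 0 := by
    have : 0 < m / (2 * ε) := by positivity
    linarith
  have key := le_exp_mul_of_hasDerivAt_le (b := ε * (couplingConst m g c * (G * W))) ha ht.le hd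
    (fun u hu => ?_)
  · have e : ε * (couplingConst m g c * (G * W)) / -(m / (2 * ε)) =
        -(2 / m * (couplingConst m g c * G) * ε ^ 2 * W) := by
      field_simp
    have hb : 0 ≤ 2 / m * (couplingConst m g c * G) * ε ^ 2 * W := by positivity
    have hexp : Real.exp (-(m / (2 * ε)) * t) ≤ 8 / (m * t) ^ 2 * ε ^ 2 := by
      have := exp_neg_le_two_div_sq (u := m / (2 * ε) * t) (by positivity)
      rw [neg_mul]
      refine this.trans (le_of_eq ?_)
      field_simp
      norm_num
    rw [e] at key
    have h1 : Real.exp (-(m / (2 * ε)) * t) * (fastEnergy g (w 0) (r 0) +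
        -(2 / m * (couplingConst m g c * G) * ε ^ 2 * W)) ≤ 8 / (m * t) ^ 2 * ε ^ 2 * W :=
      calc _ ≤ Real.exp (-(m / (2 * ε)) * t) * W :=
            mul_le_mul_of_nonneg_left (by linarith [sq_nonneg (x 0), sq_nonneg s])
              (Real.exp_pos _).le
        _ ≤ _ := mul_le_mul_of_nonneg_right hexp hW0
    linarith
  · refine (hdle u).trans ?_
    have h1 := h.energy_le hm hε hε1 hc hu.1
    have h2 : Real.exp (growthRate m g lam b c * u) ≤ G :=
      Real.exp_le_exp.2 (mul_le_mul_of_nonneg_left hu.2 hL.le)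
    have h3 := h1.trans (mul_le_mul_of_nonneg_right h2 hW0)
    gcongr

theorem sq_slow_sub_le (h : IsSlowFast m g lam b c ε s x w r f₁ f₂) (hm : 0 < m) (hε : 0 < ε)
    (hε1 : ε < 1) (hc : 0 ≤ c) {X : ℝ → ℝ} (hX : ∀ u, HasDerivAt X (lam * X u + s) u)
    (hX0 : X 0 = x 0) {t : ℝ} (ht : 0 ≤ t) :
    (x t - X t) ^ 2 ≤
      2 * (b / m) ^ 2 * (Real.exp ((2 * |lam| + 1) * t) *
          (1 + (2 * c + 2 * lam ^ 2) * Real.exp (growthRate m g lam b c * t)) +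
            Real.exp (growthRate m g lam b c * t)) * ε ^ 2 *
        (x 0 ^ 2 + fastEnergy g (w 0) (r 0) + s ^ 2) := by
  have hcc : 0 ≤ couplingConst m g c := by unfold couplingConst; positivity
  have hL : 0 < growthRate m g lam b c := by unfold growthRate; positivity
  have hQ : ∀ u, w u ^ 2 ≤ fastEnergy g (w u) (r u) := fun u =>
    le_trans (by linarith [sq_nonneg (r u)]) (sq_add_sq_le_fastEnergy g (w u) (r u))
  have hQ0 := (sq_nonneg _).trans (hQ 0)
  have hen : ∀ u ∈ Set.Icc 0 t, x u ^ 2 + fastEnergy g (w u) (r u) + s ^ 2 ≤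
      Real.exp (growthRate m g lam b c * t) *
        (x 0 ^ 2 + fastEnergy g (w 0) (r 0) + s ^ 2) := fun u hu =>
    (h.energy_le hm hε hε1 hc hu.1).trans (mul_le_mul_of_nonneg_right
      (Real.exp_le_exp.2 (mul_le_mul_of_nonneg_left hu.2 hL.le)) (by positivity))
  set W := x 0 ^ 2 + fastEnergy g (w 0) (r 0) + s ^ 2 with hW
  have hW0 : 0 ≤ W := by positivity
  set G := Real.exp (growthRate m g lam b c * t) with hG
  have hG0 : 0 < G := Real.exp_pos _
  -- The corrector `κ * w` is chosen so that its stiff part `-κ(m/ε)w` cancels the forcing `b * w`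
  -- of `x - X`; what remains carries a factor `κ = O(ε)`.
  set κ := b / m * ε with hκ
  have hD : ∀ u, HasDerivAt (fun u => x u - X u + κ * w u)
      (lam * (x u - X u + κ * w u) + κ * (f₁ u - lam * w u)) u := fun u => by
    refine (((h.slow u).sub (hX u)).add ((h.fast_fst u).const_mul κ)).congr_deriv ?_
    rw [hκ]
    field_simp
    ring
  have ha : 0 < 2 * |lam| + 1 := by positivity
  -- The `+ 1` in the rate comes from Young's inequality on `2Dκ(f₁ - lam w)`, where `D` is the
  -- corrected difference.
  have key := le_exp_mul_of_hasDerivAt_le (b := κ ^ 2 * ((2 * c + 2 * lam ^ 2) * (G * W)))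
    ha.ne' ht (fun u => (hD u).pow 2) (fun u hu => ?_)
  · simp only [Pi.pow_apply, hX0, sub_self, zero_add] at key
    have h1 : κ ^ 2 * ((2 * c + 2 * lam ^ 2) * (G * W)) / (2 * |lam| + 1) ≤
        κ ^ 2 * ((2 * c + 2 * lam ^ 2) * (G * W)) :=
      div_le_self (by positivity) (by linarith [abs_nonneg lam])
    have h1' : 0 ≤ κ ^ 2 * ((2 * c + 2 * lam ^ 2) * (G * W)) / (2 * |lam| + 1) := by positivity
    have h2 : (κ * w 0) ^ 2 ≤ κ ^ 2 * W := by
      rw [mul_pow]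
      exact mul_le_mul_of_nonneg_left (by linarith [hQ 0, sq_nonneg (x 0), sq_nonneg s])
        (sq_nonneg _)
    have h3 : (κ * w t) ^ 2 ≤ κ ^ 2 * (G * W) := by
      rw [mul_pow]
      exact mul_le_mul_of_nonneg_left
        (by linarith [hQ t, sq_nonneg (x t), sq_nonneg s, hen t ⟨ht, le_rfl⟩]) (sq_nonneg _)
    have h4 : (x t - X t + κ * w t) ^ 2 ≤ Real.exp ((2 * |lam| + 1) * t) *
        (κ ^ 2 * W + κ ^ 2 * ((2 * c + 2 * lam ^ 2) * (G * W))) :=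
      le_trans (by linarith) (key.trans
        (mul_le_mul_of_nonneg_left (add_le_add h2 h1) (Real.exp_pos _).le))
    calc (x t - X t) ^ 2 ≤ 2 * (x t - X t + κ * w t) ^ 2 + 2 * (κ * w t) ^ 2 := by
          nlinarith [sq_nonneg (x t - X t + 2 * (κ * w t))]
      _ ≤ 2 * (Real.exp ((2 * |lam| + 1) * t) *
        (κ ^ 2 * W + κ ^ 2 * ((2 * c + 2 * lam ^ 2) * (G * W)))) + 2 * (κ ^ 2 * (G * W)) := by
          linarith
      _ = _ := by rw [hκ]; ring
  · simp only [Nat.cast_ofNat, Nat.reduceSub, pow_one, Pi.pow_apply]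
    set D := x u - X u + κ * w u
    have hle : x u ^ 2 + w u ^ 2 + r u ^ 2 + s ^ 2 ≤ G * W := by
      linarith [hen u hu, sq_add_sq_le_fastEnergy g (w u) (r u)]
    have h1 : f₁ u ^ 2 ≤ c * (G * W) :=
      (h.sq_fst_le u).trans (mul_le_mul_of_nonneg_left hle hc)
    have h2 : lam ^ 2 * w u ^ 2 ≤ lam ^ 2 * (G * W) :=
      mul_le_mul_of_nonneg_left
        (by linarith [sq_nonneg (x u), sq_nonneg (r u), sq_nonneg s]) (sq_nonneg _)
    have h3 : (f₁ u - lam * w u) ^ 2 ≤ (2 * c + 2 * lam ^ 2) * (G * W) := by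
      nlinarith [sq_nonneg (f₁ u + lam * w u)]
    have h4 := mul_le_mul_of_nonneg_left h3 (sq_nonneg κ)
    have h5 : lam * D ^ 2 ≤ |lam| * D ^ 2 :=
      mul_le_mul_of_nonneg_right (le_abs_self _) (sq_nonneg _)
    nlinarith [sq_nonneg (D - κ * (f₁ u - lam * w u))]

end IsSlowFast

/-- At a positive time the slow variable follows its averaged equation and the fast variables are
slaved, both up to `O(ε)`. -/
theorem exists_slowFast_bound {m c : ℝ} (g lam b : ℝ) (hm : 0 < m) (hc : 0 ≤ c) {t : ℝ}
    (ht : 0 < t) :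
    ∃ K, 0 < K ∧ ∀ ε, 0 < ε → ε < 1 → ∀ (s : ℝ) (x w r f₁ f₂ X : ℝ → ℝ),
      IsSlowFast m g lam b c ε s x w r f₁ f₂ → (∀ u, HasDerivAt X (lam * X u + s) u) →
      X 0 = x 0 →
      (x t - X t) ^ 2 + w t ^ 2 + r t ^ 2 ≤
        K * ε ^ 2 * (x 0 ^ 2 + fastEnergy g (w 0) (r 0) + s ^ 2) := by
  have hcc : 0 ≤ couplingConst m g c := by unfold couplingConst; positivity
  set L := growthRate m g lam b c
  refine ⟨2 * (b / m) ^ 2 * (Real.exp ((2 * |lam| + 1) * t) *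
      (1 + (2 * c + 2 * lam ^ 2) * Real.exp (L * t)) + Real.exp (L * t)) +
    (8 / (m * t) ^ 2 + 2 / m * (couplingConst m g c * Real.exp (L * t))),
    by positivity, fun ε hε hε1 s x w r f₁ f₂ X h hX hX0 => ?_⟩
  have h1 := h.sq_slow_sub_le hm hε hε1 hc hX hX0 ht.le
  have h2 := h.fastEnergy_le hm hε hε1 hc ht
  have h3 := sq_add_sq_le_fastEnergy g (w t) (r t)
  have h4 := add_le_add h1 (h3.trans h2)
  rw [← add_mul, ← add_mul, ← add_assoc] at h4
  exact h4

/-! ### Affine flows and their differences. -/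

section AffineFlow

variable {E : Type*} [NormedAddCommGroup E] [NormedSpace ℝ E]

theorem affineFlow_sub (A : E →L[ℝ] E) (b : E) (t : ℝ) (v w : E) :
    affineFlow A b t v - affineFlow A b t w = affineFlow A 0 t (v - w) := by
  simp [affineFlow]

theorem affineFlow_add_time [CompleteSpace E] (A : E →L[ℝ] E) (b : E) (s t : ℝ) (v : E) :
    affineFlow A b (s + t) v = affineFlow A b t (affineFlow A b s v) := by
  have hc : Continuous fun s : ℝ => NormedSpace.exp (s • A) b :=
    continuous_iff_continuousAt.2 fun s => (hasDerivAt_exp_smul_apply A b s).continuousAt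
  have hexp : ∀ r, NormedSpace.exp ((r + t) • A) =
      NormedSpace.exp (t • A) * NormedSpace.exp (r • A) := fun r => by
    rw [add_comm r t, add_smul]
    let _ : NormedAlgebra ℚ (E →L[ℝ] E) := NormedAlgebra.restrictScalars ℚ ℝ _
    exact NormedSpace.exp_add_of_commute (((Commute.refl A).smul_left t).smul_right r)
  have hshift : ∫ r in t..(s + t), NormedSpace.exp (r • A) b =
      NormedSpace.exp (t • A) (∫ r in (0 : ℝ)..s, NormedSpace.exp (r • A) b) := by
    rw [← ContinuousLinearMap.intervalIntegral_comp_comm _ (hc.intervalIntegrable _ _)]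
    have := intervalIntegral.integral_comp_add_right (a := 0) (b := s)
      (fun r : ℝ => NormedSpace.exp (r • A) b) t
    rw [zero_add] at this
    rw [← this]
    simp only [hexp, mul_apply_eq_comp]
  rw [affineFlow, affineFlow, affineFlow, map_add, ← hshift, hexp,
    ← intervalIntegral.integral_add_adjacent_intervals (hc.intervalIntegrable 0 t)
      (hc.intervalIntegrable t (s + t))]
  simp only [mul_apply_eq_comp]
  abel

end AffineFlow

theorem bSigma_zero (ε : ℝ) : bSigma 0 ε = 0 := by
  ext i
  fin_cases i <;> simp [bSigma]

/-- Errors are propagated by the flow with `σ = 0`, so bounds valid for every `σ` serve both the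
exact solution and the errors. -/
theorem fineFlow_sub (α β γ ζ σ ε t : ℝ) (v w : CovState) :
    fineFlow α β γ ζ σ ε t v - fineFlow α β γ ζ σ ε t w = fineFlow α β γ ζ 0 ε t (v - w) := by
  simp only [fineFlow, bSigma_zero, affineFlow_sub]

theorem coarseFlow_sub (α β γ ζ σ t S S' : ℝ) :
    coarseFlow α β γ ζ σ t S - coarseFlow α β γ ζ σ t S' = coarseFlow α β γ ζ 0 t (S - S') := by
  simp [coarseFlow, affineFlow_sub]

theorem coarseFlow_zero_zero (α β γ ζ t : ℝ) : coarseFlow α β γ ζ 0 t 0 = 0 := by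
  simp [coarseFlow, affineFlow]

theorem exists_abs_coarseFlow_le (α β γ ζ t : ℝ) :
    ∃ c, 0 ≤ c ∧ ∀ σ S, |coarseFlow α β γ ζ σ t S| ≤ c * |S| + |coarseFlow α β γ ζ σ t 0| := by
  set Φ : ℝ →L[ℝ] ℝ :=
    NormedSpace.exp (t • (lambdaSigma α β γ ζ • ContinuousLinearMap.id ℝ ℝ)) with hΦ
  refine ⟨‖Φ‖, norm_nonneg _, fun σ S => ?_⟩
  have h := coarseFlow_sub α β γ ζ σ t S 0
  have h0 : coarseFlow α β γ ζ 0 t S = Φ S := by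
    simp [coarseFlow, affineFlow, hΦ]
  rw [sub_zero, h0, sub_eq_iff_eq_add] at h
  rw [h]
  exact (abs_add_le _ _).trans (add_le_add (Φ.le_opNorm S) le_rfl)

theorem hasDerivAt_coarseFlow (α β γ ζ σ S u : ℝ) :
    HasDerivAt (fun u => coarseFlow α β γ ζ σ u S)
      (lambdaSigma α β γ ζ * coarseFlow α β γ ζ σ u S + σ ^ 2) u := by
  simpa [coarseFlow] using
    hasDerivAt_affineFlow (lambdaSigma α β γ ζ • ContinuousLinearMap.id ℝ ℝ) (σ ^ 2) S u

theorem hasDerivAt_fineFlow_apply (α β γ ζ σ ε : ℝ) (v : CovState) (u : ℝ) (i : Fin 3) :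
    HasDerivAt (fun u => fineFlow α β γ ζ σ ε u v i)
      ((BSigma α β γ ζ ε).mulVec (fineFlow α β γ ζ σ ε u v).ofLp i + bSigma σ ε i) u := by
  have h := hasDerivAt_affineFlow
    (Matrix.toEuclideanCLM (n := Fin 3) (𝕜 := ℝ) (BSigma α β γ ζ ε)) (bSigma σ ε) v u
  exact ((EuclideanSpace.proj i : CovState →L[ℝ] ℝ).hasFDerivAt.comp_hasDerivAt
    u h).congr_deriv (by simp [fineFlow, Matrix.ofLp_toEuclideanCLM])

theorem covState_norm_sq (v : CovState) : ‖v‖ ^ 2 = v 0 ^ 2 + v 1 ^ 2 + v 2 ^ 2 := by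
  rw [EuclideanSpace.real_norm_sq_eq, Fin.sum_univ_three]

theorem abs_apply_le_norm (v : CovState) (i : Fin 3) : |v i| ≤ ‖v‖ := by
  simpa using PiLp.norm_apply_le v i

theorem covState_norm_le (v : CovState) : ‖v‖ ≤ |v 0| + |v 1| + |v 2| := by
  refine abs_le_of_sq_le_sq' ?_ (by positivity) |>.2
  rw [covState_norm_sq, ← sq_abs (v 0), ← sq_abs (v 1), ← sq_abs (v 2)]
  nlinarith [abs_nonneg (v 0), abs_nonneg (v 1), abs_nonneg (v 2),
    mul_nonneg (abs_nonneg (v 0)) (abs_nonneg (v 1)),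
    mul_nonneg (abs_nonneg (v 0)) (abs_nonneg (v 2)),
    mul_nonneg (abs_nonneg (v 1)) (abs_nonneg (v 2))]

/-! ### Asymptotics of the covariance flow. -/

/-- Slow-fast form of the covariance equation, in the variables measuring the distance of the fast
moments to their quasi-equilibrium. -/
theorem isSlowFast_fineFlow (α β γ ζ : ℝ) (hζ : ζ < 0) :
    ∃ c, 0 ≤ c ∧ ∀ ε, 0 < ε → ∀ (σ : ℝ) (v : CovState), ∃ f₁ f₂,
      IsSlowFast (-ζ) (γ / ζ) (lambdaSigma α β γ ζ) (2 * β) c ε (σ ^ 2)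
        (fun u => fineFlow α β γ ζ σ ε u v 0)
        (fun u => fineFlow α β γ ζ σ ε u v 1 + γ / ζ * fineFlow α β γ ζ σ ε u v 0)
        (fun u => fineFlow α β γ ζ σ ε u v 2 - (γ / ζ) ^ 2 * fineFlow α β γ ζ σ ε u v 0 +
          σ ^ 2 / (2 * ζ)) f₁ f₂ := by
  set g := γ / ζ with hg
  have hγ : γ = g * ζ := by rw [hg, div_mul_cancel₀ _ hζ.ne]
  set lam := lambdaSigma α β γ ζ with hlam
  have hlam' : lam = 2 * (α - β * g) := by rw [hlam, lambdaSigma, hg, mul_div_assoc]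
  -- Coefficients in `(x, w, r, σ²)` of the parts of `w'` and `r'` that carry no factor `1/ε`. They
  -- do not involve `ε` or `σ`, so neither does `c`.
  set a : Fin 4 → ℝ := ![α * g - β * g ^ 2, α + 2 * g * β, β, g - β / (2 * ζ)] with ha
  set b : Fin 4 → ℝ := ![-(g ^ 2 * lam), -(2 * g ^ 2 * β), 0, -g ^ 2] with hb
  set ca := a 0 ^ 2 + a 1 ^ 2 + a 2 ^ 2 + a 3 ^ 2 with hca
  set cb := b 0 ^ 2 + b 1 ^ 2 + b 2 ^ 2 + b 3 ^ 2 with hcb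
  have hca0 : 0 ≤ ca := by positivity
  have hcb0 : 0 ≤ cb := by positivity
  refine ⟨ca + cb, by positivity, fun ε hε σ v => ?_⟩
  have hx := fun u => hasDerivAt_fineFlow_apply α β γ ζ σ ε v u 0
  have hy := fun u => hasDerivAt_fineFlow_apply α β γ ζ σ ε v u 1
  have hz := fun u => hasDerivAt_fineFlow_apply α β γ ζ σ ε v u 2
  set x := fun u => fineFlow α β γ ζ σ ε u v 0 with hxd
  set y := fun u => fineFlow α β γ ζ σ ε u v 1 with hyd
  set z := fun u => fineFlow α β γ ζ σ ε u v 2 with hzd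
  simp only [BSigma, bSigma, Matrix.mulVec, dotProduct, Fin.sum_univ_three] at hx hy hz
  simp at hx hy hz
  have hζ' := hζ.ne
  refine ⟨fun u => a 0 * x u + a 1 * (y u + g * x u) +
      a 2 * (z u - g ^ 2 * x u + σ ^ 2 / (2 * ζ)) + a 3 * σ ^ 2,
    fun u => b 0 * x u + b 1 * (y u + g * x u) +
      b 2 * (z u - g ^ 2 * x u + σ ^ 2 / (2 * ζ)) + b 3 * σ ^ 2, ?_, ?_, ?_, ?_, ?_⟩
  · intro u
    refine (hx u).congr_deriv ?_
    rw [hlam']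
    ring
  · intro u
    refine ((hy u).add ((hx u).const_mul g)).congr_deriv ?_
    simp [ha, hxd, hyd, hzd]
    rw [hγ]
    field_simp
    ring
  · intro u
    refine (((hz u).sub ((hx u).const_mul (g ^ 2))).add_const _).congr_deriv ?_
    simp [hb, hxd, hyd, hzd]
    rw [hγ, hlam']
    field_simp
    ring
  · intro u
    refine (sq_linear_combination_le _ _ _ _ _ _ _ _).trans ?_
    exact mul_le_mul_of_nonneg_right (by linarith) (by positivity)
  · intro u
    refine (sq_linear_combination_le _ _ _ _ _ _ _ _).trans ?_
    exact mul_le_mul_of_nonneg_right (by linarith) (by positivity)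

theorem exists_initial_energy_le (g ζ : ℝ) :
    ∃ K, 0 < K ∧ ∀ (s : ℝ) (v : CovState),
      v 0 ^ 2 + fastEnergy g (v 1 + g * v 0) (v 2 - g ^ 2 * v 0 + s / (2 * ζ)) + s ^ 2 ≤
        K * (‖v‖ ^ 2 + s ^ 2) := by
  refine ⟨1 + (2 * g ^ 2 + 1) * (g ^ 2 + 1) + ((-g ^ 2) ^ 2 + 1 + (1 / (2 * ζ)) ^ 2),
    by positivity, fun s v => ?_⟩
  have h1 := sq_linear_combination_le g 1 0 0 (v 0) (v 1) (v 2) s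
  have h2 := sq_linear_combination_le (-g ^ 2) 0 1 (1 / (2 * ζ)) (v 0) (v 1) (v 2) s
  have h1' := mul_le_mul_of_nonneg_left h1 (by positivity : 0 ≤ 2 * g ^ 2 + 1)
  have e1 : v 1 + g * v 0 = g * v 0 + 1 * v 1 + 0 * v 2 + 0 * s := by ring
  have e2 : v 2 - g ^ 2 * v 0 + s / (2 * ζ) =
      -g ^ 2 * v 0 + 0 * v 1 + 1 * v 2 + 1 / (2 * ζ) * s := by ring
  rw [fastEnergy, e1, e2, covState_norm_sq]
  linarith [sq_nonneg (v 1), sq_nonneg (v 2)]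

/-- After a positive time the slow variance is `O(ε)`-close to the averaged flow and the fast
moments are `O(ε)`-close to their quasi-equilibrium. -/
theorem exists_fineFlow_asymptotics (α β γ : ℝ) {ζ t : ℝ} (hζ : ζ < 0) (ht : 0 < t) :
    ∃ K, 0 < K ∧ ∀ ε, 0 < ε → ε < 1 → ∀ (σ : ℝ) (v : CovState),
      |fineFlow α β γ ζ σ ε t v 0 - coarseFlow α β γ ζ σ t (v 0)| ≤ K * ε * (‖v‖ + σ ^ 2) ∧
      |fineFlow α β γ ζ σ ε t v 1 + γ / ζ * fineFlow α β γ ζ σ ε t v 0| ≤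
        K * ε * (‖v‖ + σ ^ 2) ∧
      |fineFlow α β γ ζ σ ε t v 2 - (γ / ζ) ^ 2 * fineFlow α β γ ζ σ ε t v 0 + σ ^ 2 / (2 * ζ)| ≤
        K * ε * (‖v‖ + σ ^ 2) := by
  obtain ⟨c, hc, hsf⟩ := isSlowFast_fineFlow α β γ ζ hζ
  obtain ⟨K₁, hK₁, hb⟩ := exists_slowFast_bound (γ / ζ) (lambdaSigma α β γ ζ) (2 * β)
    (neg_pos.2 hζ) hc ht
  obtain ⟨K₂, hK₂, hi⟩ := exists_initial_energy_le (γ / ζ) ζ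
  -- `P + 1` dominates `√P` for `P = K₁ * K₂`, which avoids square roots.
  refine ⟨K₁ * K₂ + 1, by positivity, fun ε hε hε1 σ v => ?_⟩
  obtain ⟨f₁, f₂, h⟩ := hsf ε hε σ v
  have h0 : fineFlow α β γ ζ σ ε 0 v = v := affineFlow_zero _ _ _
  have key := hb ε hε hε1 _ _ _ _ _ _ (fun u => coarseFlow α β γ ζ σ u (v 0)) h
    (fun u => hasDerivAt_coarseFlow α β γ ζ σ (v 0) u)
    (by simp only [h0]; exact affineFlow_zero _ _ _)
  simp only [h0] at key
  have hsum : ‖v‖ ^ 2 + (σ ^ 2) ^ 2 ≤ (‖v‖ + σ ^ 2) ^ 2 := by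
    nlinarith [mul_nonneg (norm_nonneg v) (sq_nonneg σ)]
  have hP : 0 < K₁ * K₂ := by positivity
  have key2 := key.trans (mul_le_mul_of_nonneg_left ((hi (σ ^ 2) v).trans
    (mul_le_mul_of_nonneg_left hsum hK₂.le)) (by positivity))
  have hsq : K₁ * ε ^ 2 * (K₂ * (‖v‖ + σ ^ 2) ^ 2) ≤
      ((K₁ * K₂ + 1) * ε * (‖v‖ + σ ^ 2)) ^ 2 := by
    have : K₁ * K₂ ≤ (K₁ * K₂ + 1) ^ 2 := by nlinarith
    calc K₁ * ε ^ 2 * (K₂ * (‖v‖ + σ ^ 2) ^ 2) = K₁ * K₂ * (ε * (‖v‖ + σ ^ 2)) ^ 2 := by ring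
      _ ≤ (K₁ * K₂ + 1) ^ 2 * (ε * (‖v‖ + σ ^ 2)) ^ 2 :=
        mul_le_mul_of_nonneg_right this (sq_nonneg _)
      _ = _ := by ring
  have hpos : 0 ≤ (K₁ * K₂ + 1) * ε * (‖v‖ + σ ^ 2) := by positivity
  have key3 := key2.trans hsq
  refine ⟨abs_le_of_sq_le_sq ?_ hpos, abs_le_of_sq_le_sq ?_ hpos, abs_le_of_sq_le_sq ?_ hpos⟩
  all_goals
    refine le_trans ?_ key3
    linarith [sq_nonneg (fineFlow α β γ ζ σ ε t v 0 - coarseFlow α β γ ζ σ t (v 0)),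
      sq_nonneg (fineFlow α β γ ζ σ ε t v 1 + γ / ζ * fineFlow α β γ ζ σ ε t v 0),
      sq_nonneg (fineFlow α β γ ζ σ ε t v 2 - (γ / ζ) ^ 2 * fineFlow α β γ ζ σ ε t v 0 +
        σ ^ 2 / (2 * ζ))]

/-- The form of `exists_fineFlow_asymptotics` used in the error recursion. -/
theorem exists_fineFlow_bounds (α β γ : ℝ) {ζ t : ℝ} (hζ : ζ < 0) (ht : 0 < t) :
    ∃ K, 0 < K ∧ ∀ ε, 0 < ε → ε < 1 → ∀ (σ : ℝ) (v : CovState),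
      |fineFlow α β γ ζ σ ε t v 0 - coarseFlow α β γ ζ σ t (v 0)| ≤ K * (ε * (‖v‖ + σ ^ 2)) ∧
      |fineFlow α β γ ζ σ ε t v 1| + |fineFlow α β γ ζ σ ε t v 2| ≤
        K * (|v 0| + |coarseFlow α β γ ζ σ t 0| + ε * (‖v‖ + σ ^ 2) + σ ^ 2) := by
  obtain ⟨K, hK, h⟩ := exists_fineFlow_asymptotics α β γ hζ ht
  obtain ⟨c, hc, hcoarse⟩ := exists_abs_coarseFlow_le α β γ ζ t
  set g := γ / ζ with hg
  refine ⟨(1 + |g| + g ^ 2) * (c + 1) + K * (|g| + g ^ 2 + 2) + |1 / (2 * ζ)|, by positivity,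
    fun ε hε hε1 σ v => ?_⟩
  obtain ⟨h1, h2, h3⟩ := h ε hε hε1 σ v
  rw [mul_assoc] at h1 h2 h3
  set δ := ε * (‖v‖ + σ ^ 2) with hδ
  have hδ0 : 0 ≤ δ := by positivity
  set F := fineFlow α β γ ζ σ ε t v
  set C₀ := |coarseFlow α β γ ζ σ t 0|
  have hC₀ : 0 ≤ C₀ := abs_nonneg _
  -- The slow value depends on `v 1` and `v 2` only through `δ`; the fast moments follow it by
  -- slaving.
  have hx : |F 0| ≤ c * |v 0| + C₀ + K * δ := by
    have := abs_add_le (F 0 - coarseFlow α β γ ζ σ t (v 0)) (coarseFlow α β γ ζ σ t (v 0))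
    rw [sub_add_cancel] at this
    linarith [hcoarse σ (v 0)]
  have hgx : |g| * |F 0| ≤ |g| * (c * |v 0| + C₀ + K * δ) := by gcongr
  have hgx2 : g ^ 2 * |F 0| ≤ g ^ 2 * (c * |v 0| + C₀ + K * δ) := by gcongr
  have hy : |F 1| ≤ K * δ + |g| * |F 0| := by
    have := abs_sub (F 1 + g * F 0) (g * F 0)
    rw [add_sub_cancel_right, abs_mul] at this
    linarith
  have hz : |F 2| ≤ K * δ + g ^ 2 * |F 0| + |1 / (2 * ζ)| * σ ^ 2 := by
    have e : F 2 = (F 2 - g ^ 2 * F 0 + σ ^ 2 / (2 * ζ)) + g ^ 2 * F 0 +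
      -(1 / (2 * ζ) * σ ^ 2) := by ring
    have := abs_add_three (F 2 - g ^ 2 * F 0 + σ ^ 2 / (2 * ζ)) (g ^ 2 * F 0)
      (-(1 / (2 * ζ) * σ ^ 2))
    rw [← e, abs_neg, abs_mul, abs_mul, abs_of_nonneg (sq_nonneg g),
      abs_of_nonneg (sq_nonneg σ)] at this
    linarith
  have hκ := abs_nonneg (1 / (2 * ζ))
  have hv := abs_nonneg (v 0)
  have hg0 := abs_nonneg g
  constructor
  · refine h1.trans (mul_le_mul_of_nonneg_right ?_ hδ0)
    nlinarith [mul_nonneg hK.le hg0, mul_nonneg hK.le (sq_nonneg g), mul_nonneg hc hg0,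
      mul_nonneg hc (sq_nonneg g)]
  · set A := (1 + |g| + g ^ 2) * (c + 1) with hA
    set B := K * (|g| + g ^ 2 + 2) with hB
    have hA0 : 0 ≤ A := by positivity
    have hB0 : 0 ≤ B := by positivity
    have hAc : (|g| + g ^ 2) * c ≤ A := by
      rw [hA]; nlinarith [sq_nonneg g]
    have hA1 : |g| + g ^ 2 ≤ A := by
      rw [hA]; nlinarith [sq_nonneg g, mul_nonneg hc hg0, mul_nonneg hc (sq_nonneg g)]
    have t1 := mul_le_mul_of_nonneg_right hAc hv
    have t2 := mul_le_mul_of_nonneg_right hA1 hC₀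
    have t3 : |F 1| + |F 2| ≤ A * |v 0| + A * C₀ + B * δ + |1 / (2 * ζ)| * σ ^ 2 := by
      rw [hB]; linarith
    refine t3.trans ?_
    have p1 : 0 ≤ A * (δ + σ ^ 2) := by positivity
    have p2 : 0 ≤ B * (|v 0| + C₀ + σ ^ 2) := by positivity
    have p3 : 0 ≤ |1 / (2 * ζ)| * (|v 0| + C₀ + δ) := by positivity
    linarith

/-! ### Stability from the eigenvalues of `A_Σ(ε)`. -/

/-- A uniform fast decay rate forces the averaged fast dynamics to be stable. -/
theorem IsFastDecayRate.zeta_neg {α β γ ζ μ : ℝ} (h : IsFastDecayRate α β γ ζ μ) : ζ < 0 := by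
  obtain ⟨hμ, h⟩ := h
  have htr : ∀ ε ∈ Set.Ioo (0 : ℝ) 1, 2 * μ ≤ -(α * ε + 3 * ζ) := by
    intro ε hε
    set M := (ASigma α β γ ζ ε).map (algebraMap ℝ ℂ) with hM
    obtain ⟨z, hz⟩ := spectrum.nonempty_of_isAlgClosed_of_finiteDimensional ℂ M
    have hmem : ∀ z, z ∈ spectrum ℂ M ↔ z ^ 2 - M.trace * z + M.det = 0 := fun z => by
      rw [Matrix.mem_spectrum_iff_isRoot_charpoly, Matrix.charpoly_fin_two]
      simp [Polynomial.IsRoot]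
    -- The trace minus one root is the other root, so the trace is at least `2μ`, even for a double
    -- eigenvalue.
    have hz' : M.trace - z ∈ spectrum ℂ M := by
      rw [hmem] at hz ⊢
      rw [← hz]
      ring
    have h1 := h ε hε z hz
    have h2 := h ε hε _ hz'
    have h3 : M.trace.re = -(α * ε + 3 * ζ) := by
      simp [hM, ASigma, Matrix.trace_fin_two]
      ring
    rw [Complex.sub_re, h3] at h2
    linarith
  have hα : 0 < |α| + μ + 1 := by positivity
  -- This `ε` makes `αε ≥ -μ`, which leaves `3ζ ≤ -μ`.
  have hε := htr (μ / (|α| + μ + 1)) ⟨by positivity, by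
    rw [div_lt_one hα]; linarith [abs_nonneg α]⟩
  have hb : -μ ≤ α * (μ / (|α| + μ + 1)) := by
    rw [mul_div_assoc', le_div_iff₀ hα]
    nlinarith [neg_abs_le α, mul_pos hμ hμ]
  linarith

theorem floor_add_one_div_two (k : ℕ) : ⌊((k : ℝ) + 1) / 2⌋₊ = (k + 1) / 2 := by
  have := Nat.floor_div_eq_div (K := ℝ) (k + 1) 2
  push_cast at this
  exact this

theorem ceil_add_one_div_two (k : ℕ) : ⌈((k : ℝ) + 1) / 2⌉₊ = (k + 2) / 2 := by
  rw [Nat.ceil_eq_iff (by omega)]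
  have h1 : (((k + 2) / 2 - 1 : ℕ) : ℝ) * 2 < k + 1 := by
    have : ((k + 2) / 2 - 1) * 2 < k + 1 := by omega
    exact_mod_cast this
  have h2 : (k : ℝ) + 1 ≤ ((k + 2) / 2 : ℕ) * 2 := by
    have : k + 1 ≤ ((k + 2) / 2) * 2 := by omega
    exact_mod_cast this
  constructor <;> linarith

/-! ### Recursions for the macro and micro errors. -/

section ErrorRecursion

variable (α β γ ζ σ : ℝ) (s₀ : CovState) (ε Δt : ℝ)

/-- The macro state of an iterate is the restriction of its micro state. -/
theorem parareal_fst_eq (k n : ℕ) :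
    (parareal (coarseFlow α β γ ζ σ Δt) (fineFlow α β γ ζ σ ε Δt)
      restrict (lifting s₀) matching s₀ k n).1 = restrict (covIterate α β γ ζ σ s₀ ε Δt k n) := by
  cases k <;> cases n <;>
    simp [covIterate, parareal, pararealInit, pararealStep, restrict, lifting, matching]

theorem fineFlow_succ_step (n : ℕ) :
    fineFlow α β γ ζ σ ε ((n + 1 : ℕ) * Δt) s₀ =
      fineFlow α β γ ζ σ ε Δt (fineFlow α β γ ζ σ ε (n * Δt) s₀) := by
  rw [Nat.cast_succ, add_mul, one_mul]
  exact affineFlow_add_time _ _ _ _ _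

theorem macroError_eq (k n : ℕ) :
    macroError α β γ ζ σ s₀ ε Δt k n = microError α β γ ζ σ s₀ ε Δt k n 0 := by
  simp [macroError, microError, restrict]

theorem microError_time_zero (k : ℕ) : microError α β γ ζ σ s₀ ε Δt k 0 = 0 := by
  have h : fineFlow α β γ ζ σ ε 0 s₀ = s₀ := affineFlow_zero _ _ _
  cases k <;> simp [microError, covIterate, parareal, pararealInit, pararealStep, h]

theorem covIterate_zero_succ (n : ℕ) :
    covIterate α β γ ζ σ s₀ ε Δt 0 (n + 1) =
      lifting s₀ (coarseFlow α β γ ζ σ Δt (restrict (covIterate α β γ ζ σ s₀ ε Δt 0 n))) := by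
  rw [← parareal_fst_eq]
  rfl

theorem covIterate_succ_succ (k n : ℕ) :
    covIterate α β γ ζ σ s₀ ε Δt (k + 1) (n + 1) =
      matching (coarseFlow α β γ ζ σ Δt (restrict (covIterate α β γ ζ σ s₀ ε Δt (k + 1) n)) +
          restrict (fineFlow α β γ ζ σ ε Δt (covIterate α β γ ζ σ s₀ ε Δt k n)) -
          coarseFlow α β γ ζ σ Δt (restrict (covIterate α β γ ζ σ s₀ ε Δt k n)))
        (fineFlow α β γ ζ σ ε Δt (covIterate α β γ ζ σ s₀ ε Δt k n)) := by
  rw [← parareal_fst_eq, ← parareal_fst_eq]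
  rfl

/-- The source is the consistency error of the coarse flow along the exact solution. -/
theorem macroError_zero_succ (n : ℕ) :
    macroError α β γ ζ σ s₀ ε Δt 0 (n + 1) =
      coarseFlow α β γ ζ 0 Δt (macroError α β γ ζ σ s₀ ε Δt 0 n) -
        (fineFlow α β γ ζ σ ε Δt (fineFlow α β γ ζ σ ε (n * Δt) s₀) 0 -
          coarseFlow α β γ ζ σ Δt (fineFlow α β γ ζ σ ε (n * Δt) s₀ 0)) := by
  rw [macroError, macroError, covIterate_zero_succ, fineFlow_succ_step, ← coarseFlow_sub α β γ ζ σ]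
  simp [restrict, lifting]

/-- The previous error enters only through the difference of fine and coarse flow, which is small of
order `ε`. -/
theorem macroError_succ_succ (k n : ℕ) :
    macroError α β γ ζ σ s₀ ε Δt (k + 1) (n + 1) =
      coarseFlow α β γ ζ 0 Δt (macroError α β γ ζ σ s₀ ε Δt (k + 1) n) +
        (fineFlow α β γ ζ 0 ε Δt (microError α β γ ζ σ s₀ ε Δt k n) 0 -
          coarseFlow α β γ ζ 0 Δt (microError α β γ ζ σ s₀ ε Δt k n 0)) := by
  rw [← macroError_eq]
  simp only [macroError, microError]
  rw [covIterate_succ_succ, fineFlow_succ_step, ← coarseFlow_sub α β γ ζ σ,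
    ← coarseFlow_sub α β γ ζ σ, ← fineFlow_sub α β γ ζ σ]
  simp [restrict, matching]
  ring

/-- Matching changes only the slow component, so the fast ones come straight from the fine flow. -/
theorem microError_succ_succ_fast (k n : ℕ) {i : Fin 3} (hi : i ≠ 0) :
    microError α β γ ζ σ s₀ ε Δt (k + 1) (n + 1) i =
      fineFlow α β γ ζ 0 ε Δt (microError α β γ ζ σ s₀ ε Δt k n) i := by
  simp only [microError]
  rw [covIterate_succ_succ, fineFlow_succ_step, ← fineFlow_sub α β γ ζ σ]
  fin_cases i
  · exact absurd rfl hi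
  all_goals simp [matching]

end ErrorRecursion

/-! ### Orders in `ε` by induction on `k`. -/

section Convergence

variable (α β γ : ℝ) {ζ Δt : ℝ}

/-- The exact covariance is bounded on the time grid, uniformly in `ε`. -/
theorem exists_norm_fineFlow_le (hζ : ζ < 0) (hΔt : 0 < Δt) (σ : ℝ) (s₀ : CovState) (n : ℕ) :
    ∃ B, 0 < B ∧ ∀ ε, 0 < ε → ε < 1 → ‖fineFlow α β γ ζ σ ε (n * Δt) s₀‖ ≤ B := by
  obtain ⟨K, hK, hF⟩ := exists_fineFlow_bounds α β γ hζ hΔt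
  obtain ⟨c, hc, hC⟩ := exists_abs_coarseFlow_le α β γ ζ Δt
  induction n with
  | zero =>
    refine ⟨‖s₀‖ + 1, by positivity, fun ε _ _ => ?_⟩
    have h : fineFlow α β γ ζ σ ε 0 s₀ = s₀ := affineFlow_zero _ _ _
    simp [h]
  | succ n ih =>
    obtain ⟨B, hB, hu⟩ := ih
    set C₀ := |coarseFlow α β γ ζ σ Δt 0|
    refine ⟨c * B + C₀ + K * (B + σ ^ 2) + K * (B + C₀ + (B + σ ^ 2) + σ ^ 2), by positivity,
      fun ε hε hε1 => ?_⟩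
    rw [fineFlow_succ_step]
    have hv := hu ε hε hε1
    set v := fineFlow α β γ ζ σ ε (n * Δt) s₀
    obtain ⟨h1, h2⟩ := hF ε hε hε1 σ v
    have h0 : |v 0| ≤ B := (abs_apply_le_norm v 0).trans hv
    have hδ : ε * (‖v‖ + σ ^ 2) ≤ B + σ ^ 2 :=
      (mul_le_of_le_one_left (by positivity) hε1.le).trans (by linarith)
    have h1' := h1.trans (mul_le_mul_of_nonneg_left hδ hK.le)
    have h2' : _ ≤ K * (B + C₀ + (B + σ ^ 2) + σ ^ 2) :=
      h2.trans (mul_le_mul_of_nonneg_left (by linarith) hK.le)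
    have h3 := (hC σ (v 0)).trans (add_le_add_left (mul_le_mul_of_nonneg_left h0 hc) _)
    have h4 := abs_add_le (fineFlow α β γ ζ σ ε Δt v 0 - coarseFlow α β γ ζ σ Δt (v 0))
      (coarseFlow α β γ ζ σ Δt (v 0))
    rw [sub_add_cancel] at h4
    linarith [covState_norm_le (fineFlow α β γ ζ σ ε Δt v)]

/-- The macro error accumulates `O(ε)` consistency errors. Lifting resets the fast moments to their
initial values, so the micro error is merely bounded. -/
theorem exists_error_le_init (hζ : ζ < 0) (hΔt : 0 < Δt) (σ : ℝ) (s₀ : CovState) (n : ℕ) :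
    ∃ C, 0 < C ∧ ∀ ε, 0 < ε → ε < 1 →
      |macroError α β γ ζ σ s₀ ε Δt 0 n| ≤ C * ε ∧
      ‖microError α β γ ζ σ s₀ ε Δt 0 n‖ ≤ C := by
  obtain ⟨K, hK, hF⟩ := exists_fineFlow_bounds α β γ hζ hΔt
  obtain ⟨c, hc, hC⟩ := exists_abs_coarseFlow_le α β γ ζ Δt
  induction n with
  | zero =>
    refine ⟨1, one_pos, fun ε hε _ => ?_⟩
    rw [macroError_eq, microError_time_zero]
    simp [hε.le]
  | succ n ih =>
    obtain ⟨C, hC0, hind⟩ := ih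
    obtain ⟨B, hB, hu⟩ := exists_norm_fineFlow_le α β γ hζ hΔt σ s₀ n
    obtain ⟨B', hB', hu'⟩ := exists_norm_fineFlow_le α β γ hζ hΔt σ s₀ (n + 1)
    refine ⟨c * C + K * (B + σ ^ 2) + 2 * (‖s₀‖ + B'), by positivity, fun ε hε hε1 => ?_⟩
    have h1 := (hF ε hε hε1 σ (fineFlow α β γ ζ σ ε (n * Δt) s₀)).1
    have h2 : ε * (‖fineFlow α β γ ζ σ ε (n * Δt) s₀‖ + σ ^ 2) ≤ ε * (B + σ ^ 2) := by
      have := hu ε hε hε1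
      gcongr
    have h3 := hC 0 (macroError α β γ ζ σ s₀ ε Δt 0 n)
    rw [coarseFlow_zero_zero, abs_zero, add_zero] at h3
    have h4 := mul_le_mul_of_nonneg_left (hind ε hε hε1).1 hc
    have hE : |macroError α β γ ζ σ s₀ ε Δt 0 (n + 1)| ≤ (c * C + K * (B + σ ^ 2)) * ε := by
      rw [macroError_zero_succ]
      refine (abs_sub _ _).trans ?_
      linarith [h1.trans (mul_le_mul_of_nonneg_left h2 hK.le)]
    have hP : 0 ≤ c * C + K * (B + σ ^ 2) := by positivity
    refine ⟨hE.trans (mul_le_mul_of_nonneg_right (by linarith [norm_nonneg s₀]) hε.le), ?_⟩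
    have hfast : ∀ i : Fin 3, i ≠ 0 →
        |microError α β γ ζ σ s₀ ε Δt 0 (n + 1) i| ≤ ‖s₀‖ + B' := by
      intro i hi
      have e : microError α β γ ζ σ s₀ ε Δt 0 (n + 1) i =
          s₀ i - fineFlow α β γ ζ σ ε ((n + 1 : ℕ) * Δt) s₀ i := by
        rw [microError, covIterate_zero_succ]
        fin_cases i
        · exact absurd rfl hi
        all_goals simp [lifting]
      rw [e]
      exact (abs_sub _ _).trans (add_le_add (abs_apply_le_norm _ _)
        ((abs_apply_le_norm _ _).trans (hu' ε hε hε1)))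
    have hn := covState_norm_le (microError α β γ ζ σ s₀ ε Δt 0 (n + 1))
    rw [← macroError_eq] at hn
    have := hE.trans (mul_le_of_le_one_right hP hε1.le)
    linarith [hfast 1 (by decide), hfast 2 (by decide)]

/-- One Parareal iteration raises the order of the macro error to one more than that of the
previous micro error, and the order of the micro error to that of the previous macro error. -/
theorem exists_error_le_step (hζ : ζ < 0) (hΔt : 0 < Δt) (σ : ℝ) (s₀ : CovState) (k a b : ℕ)
    (hab : a ≤ b + 1)
    (h : ∀ n, ∃ C, 0 < C ∧ ∀ ε, 0 < ε → ε < 1 →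
      |macroError α β γ ζ σ s₀ ε Δt k n| ≤ C * ε ^ a ∧
      ‖microError α β γ ζ σ s₀ ε Δt k n‖ ≤ C * ε ^ b) (n : ℕ) :
    ∃ C, 0 < C ∧ ∀ ε, 0 < ε → ε < 1 →
      |macroError α β γ ζ σ s₀ ε Δt (k + 1) n| ≤ C * ε ^ (b + 1) ∧
      ‖microError α β γ ζ σ s₀ ε Δt (k + 1) n‖ ≤ C * ε ^ a := by
  obtain ⟨K, hK, hF⟩ := exists_fineFlow_bounds α β γ hζ hΔt
  obtain ⟨c, hc, hC⟩ := exists_abs_coarseFlow_le α β γ ζ Δt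
  induction n with
  | zero =>
    refine ⟨1, one_pos, fun ε hε _ => ?_⟩
    rw [macroError_eq, microError_time_zero]
    simp [pow_nonneg hε.le]
  | succ n ih =>
    obtain ⟨C₁, hC₁, hind⟩ := ih
    obtain ⟨C₂, hC₂, hprev⟩ := h n
    refine ⟨c * C₁ + K * C₂ + 2 * K * C₂, by positivity, fun ε hε hε1 => ?_⟩
    obtain ⟨hE, he⟩ := hprev ε hε hε1
    set e := microError α β γ ζ σ s₀ ε Δt k n with he_def
    obtain ⟨h1, h2⟩ := hF ε hε hε1 0 e
    rw [macroError_eq, ← he_def] at hE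
    rw [coarseFlow_zero_zero, abs_zero] at h2
    simp only [ne_eq, OfNat.ofNat_ne_zero, not_false_eq_true, zero_pow, add_zero] at h1 h2
    have hpow : ε ^ (b + 1) ≤ ε ^ a := pow_le_pow_of_le_one hε.le hε1.le hab
    have hεe : ε * ‖e‖ ≤ C₂ * ε ^ (b + 1) := by
      calc ε * ‖e‖ ≤ ε * (C₂ * ε ^ b) := mul_le_mul_of_nonneg_left he hε.le
        _ = _ := by ring
    have h3 := hC 0 (macroError α β γ ζ σ s₀ ε Δt (k + 1) n)
    rw [coarseFlow_zero_zero, abs_zero, add_zero] at h3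
    have h4 := mul_le_mul_of_nonneg_left (hind ε hε hε1).1 hc
    have hE' : |macroError α β γ ζ σ s₀ ε Δt (k + 1) (n + 1)| ≤
        (c * C₁ + K * C₂) * ε ^ (b + 1) := by
      rw [macroError_succ_succ]
      refine (abs_add_le _ _).trans ?_
      linarith [h1.trans (mul_le_mul_of_nonneg_left hεe hK.le)]
    refine ⟨hE'.trans (mul_le_mul_of_nonneg_right (by linarith [mul_pos hK hC₂])
      (by positivity)), ?_⟩
    have hn := covState_norm_le (microError α β γ ζ σ s₀ ε Δt (k + 1) (n + 1))
    rw [← macroError_eq, microError_succ_succ_fast _ _ _ _ _ _ _ _ _ _ (by decide),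
      microError_succ_succ_fast _ _ _ _ _ _ _ _ _ _ (by decide), ← he_def] at hn
    have h5 : C₂ * ε ^ (b + 1) ≤ C₂ * ε ^ a := mul_le_mul_of_nonneg_left hpow hC₂.le
    -- The old macro error has order `a`; the rest has order `b + 1`, which is no worse by `hab`.
    have h6 : |e 0| + ε * ‖e‖ ≤ 2 * C₂ * ε ^ a := by linarith
    have h7 := h2.trans (mul_le_mul_of_nonneg_left h6 hK.le)
    have h8 := hE'.trans (mul_le_mul_of_nonneg_left hpow (by positivity))
    linarith

theorem exists_error_le (hζ : ζ < 0) (hΔt : 0 < Δt) (σ : ℝ) (s₀ : CovState) (k : ℕ) :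
    ∀ n, ∃ C, 0 < C ∧ ∀ ε, 0 < ε → ε < 1 →
      |macroError α β γ ζ σ s₀ ε Δt k n| ≤ C * ε ^ ((k + 2) / 2) ∧
      ‖microError α β γ ζ σ s₀ ε Δt k n‖ ≤ C * ε ^ ((k + 1) / 2) := by
  induction k with
  -- Here the exponents are `(0 + 2)/2 = 1` and `(0 + 1)/2 = 0`.
  | zero => simpa using exists_error_le_init α β γ hζ hΔt σ s₀
  | succ k ih =>
    have h := exists_error_le_step α β γ hζ hΔt σ s₀ k _ _ (by omega) ih
    have e : (k + 1 + 2) / 2 = (k + 1) / 2 + 1 := by omega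
    rw [e]
    exact h

end Convergence

end MicroMacro

theorem mainTheorem1 (α β γ ζ T : ℝ) (hT : 0 < T)
    (hlam : MicroMacro.lambdaSigma α β γ ζ ≠ 0)
    (hlamEps : ∀ ε ∈ Set.Ioo (0 : ℝ) 1, MicroMacro.lambdaSigmaEps α β γ ζ ε ≠ 0) :
    ∃ ε₀ ∈ Set.Ioo (0 : ℝ) 1,
      ∀ μ : ℝ, MicroMacro.IsFastDecayRate α β γ ζ μ →
      ∀ (σ : ℝ) (s₀ : MicroMacro.CovState) (N : ℕ) (Δt : ℝ), (N : ℝ) * Δt = T →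
      ∀ k : ℕ, ∃ C : ℝ, 0 < C ∧
        ∀ ε : ℝ, 0 < ε → ε < ε₀ → MicroMacro.boundaryLayer μ ε < Δt →
          ∀ n ≤ N,
            |MicroMacro.macroError α β γ ζ σ s₀ ε Δt k n| ≤ C * ε ^ ⌈((k : ℝ) + 1) / 2⌉₊ ∧
            ‖MicroMacro.microError α β γ ζ σ s₀ ε Δt k n‖ ≤ C * ε ^ ⌊((k : ℝ) + 1) / 2⌋₊ := by
  -- All estimates hold for `0 < ε < 1`, so any `ε₀` in `(0, 1)` serves.
  refine ⟨1 / 2, by norm_num, fun μ hμ σ s₀ N Δt hN k => ?_⟩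
  have hΔt : 0 < Δt := pos_of_mul_pos_right (hN ▸ hT) N.cast_nonneg
  choose C hC hbound using MicroMacro.exists_error_le α β γ hμ.zeta_neg hΔt σ s₀ k
  -- The constants depend on `n`; their sum over the `N + 1` grid points dominates each.
  refine ⟨∑ n ∈ Finset.range (N + 1), C n,
    Finset.sum_pos (fun n _ => hC n) Finset.nonempty_range_add_one,
    fun ε hε hε₀ _ n hn => ?_⟩
  have hle : C n ≤ ∑ n ∈ Finset.range (N + 1), C n :=
    Finset.single_le_sum (fun i _ => (hC i).le) (Finset.mem_range.2 (by omega))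
  rw [MicroMacro.ceil_add_one_div_two, MicroMacro.floor_add_one_div_two]
  obtain ⟨h1, h2⟩ := hbound n ε hε (by linarith)
  exact ⟨h1.trans (mul_le_mul_of_nonneg_right hle (by positivity)),
    h2.trans (mul_le_mul_of_nonneg_right hle (by positivity))⟩
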